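/- Let $(\mathcal X,\mu)$ be a probability space and $k:\mathcal X\times\mathcal X\to\mathbb R$ a measurable (symmetric) positive semi-definite kernel with $\int_{\mathcal X}k(x,x)\,d\mu(x)<\infty$. Let $\sigma_1\ge\sigma_2\ge\cdots\ge 0$ be the eigenvalues, repeated according to multiplicity and padded with zeros if only finitely many are nonzero, of the integral operator $\mathcal K:L^2(\mu)\to L^2(\mu)$, $(\mathcal Kf)(x)=\int_{\mathcal X}k(x,y)f(y)\,d\mu(y)$ (only the nonzero eigenvalues matter below). Fix points $Z=(z_i)_{i=1}^{\ell}$ in $\mathcal X$, and for points $a_1,\dots,a_p$ and $b_1,\dots,b_q$ write $k(a,b)=(k(a_i,b_j))_{i,j}$. With $A^+$ denoting the Moore–Penrose pseudo-inverse, put $k^Z(x,y)=k(x,Z)\,k(Z,Z)^+k(Z,y)$. For $X=(x_j)_{j=1}^M\in\mathcal X^M$, let $\mu_X=\frac1M\sum_{j=1}^M\delta_{x_j}$ and $h_X(x,y)=\frac1M\sum_{j=1}^M k(x,x_j)k(x_j,y)$. Choose $H\in\mathbb R^{\ell\times\ell}$ with $H^\top H=h_X(Z,Z)$ and a singular value decomposition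 $Hk(Z,Z)^+H^\top=V\operatorname{diag}(\kappa_1,\dots,\kappa_\ell)V^\top$ with $V=[v_1,\dots,v_\ell]$ orthogonal and $\kappa_1\ge\cdots\ge\kappa_\ell\ge0$. Let $f_i(x)=(H^+v_i)^\top k(Z,x)$ and $$k_X^Z(x,y)=\sum_{i=1}^{\ell}\kappa_i f_i(x)f_i(y),\qquad k_{s,X}^Z(x,y)=\sum_{i=1}^{\min(s,\ell)}\kappa_i f_i(x)f_i(y)\qquad(s\ge0).$$ For $g:\mathcal X\times\mathcal X\to\mathbb R$ write $\mu_X(g)=\int_{\mathcal X} g(x,x)\,d\mu_X(x)$. Let $M\ge1$ and let $X=(x_1,\dots,x_M)$ be an i.i.d. sample from $\mu$. Then, for every integer $s\ge0$ and however $H$ and the singular value decomposition are chosen for each sample, the random variables $\mu_X(k^Z-k_{s,X}^Z)$ and $\mu_X(k_X^Z-k_{s,X}^Z)$ are integrable, $\sum_{i>s}\sigma_i<\infty$, and $$\mathbb E\big[\mu_X(k^Z-k_{s,X}^Z)\big]=\mathbb E\big[\mu_X(k_X^Z-k_{s,X}^Z)\big]\le\sum_{i>s}\sigma_i .$$ 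-/

import Mathlib

open MeasureTheory ProbabilityTheory Filter Topology
open scoped Matrix ENNReal

namespace Nystrom

/-! ### The Moore–Penrose pseudo-inverse of a real matrix -/

/-- The four Penrose equations: `B` is the Moore–Penrose pseudo-inverse of `A`. -/
structure IsMoorePenrose {m n : Type*} [Fintype m] [Fintype n]
    (A : Matrix m n ℝ) (B : Matrix n m ℝ) : Prop where
  mul_mul_self : A * B * A = A
  self_mul_mul : B * A * B = B
  left_symm : (A * B)ᵀ = A * B
  right_symm : (B * A)ᵀ = B * A

theorem IsMoorePenrose.unique {m n : Type*} [Fintype m] [Fintype n]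
    {A : Matrix m n ℝ} {B C : Matrix n m ℝ}
    (hB : IsMoorePenrose A B) (hC : IsMoorePenrose A C) : B = C := by
  have h1 : A * B = A * C := by
    calc A * B = (A * B)ᵀ := hB.left_symm.symm
      _ = (A * C * (A * B))ᵀ := by rw [← Matrix.mul_assoc, hC.mul_mul_self]
      _ = A * B * (A * C) := by rw [Matrix.transpose_mul, hB.left_symm, hC.left_symm]
      _ = A * C := by rw [← Matrix.mul_assoc, hB.mul_mul_self]
  have h2 : B * A = C * A := by
    calc B * A = (B * A)ᵀ := hB.right_symm.symm
      _ = (B * A * (C * A))ᵀ := by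
          rw [Matrix.mul_assoc B A, ← Matrix.mul_assoc A C, hC.mul_mul_self]
      _ = C * A * (B * A) := by rw [Matrix.transpose_mul, hB.right_symm, hC.right_symm]
      _ = C * A := by rw [Matrix.mul_assoc C A, ← Matrix.mul_assoc A B, hB.mul_mul_self]
  calc B = B * A * B := hB.self_mul_mul.symm
    _ = C * (A * B) := by rw [h2, Matrix.mul_assoc]
    _ = C := by rw [h1, ← Matrix.mul_assoc, hC.self_mul_mul]

theorem exists_isMoorePenrose_of_symm {n : Type*} [Fintype n]
    (S : Matrix n n ℝ) (hS : S.IsHermitian) :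
    ∃ T : Matrix n n ℝ, Tᵀ = T ∧ IsMoorePenrose S T := by
  classical
  obtain ⟨U, d, hU, hd⟩ : ∃ (U : Matrix n n ℝ) (d : n → ℝ),
      Uᵀ * U = 1 ∧ S = U * Matrix.diagonal d * Uᵀ := by
    refine ⟨hS.eigenvectorUnitary, hS.eigenvalues, ?_, ?_⟩
    · have := Unitary.coe_star_mul_self hS.eigenvectorUnitary
      simpa [Matrix.star_eq_conjTranspose, Matrix.conjTranspose_eq_transpose_of_trivial] using this
    · have := hS.spectral_theorem
      rw [Unitary.conjStarAlgAut_apply] at this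
      simpa [Matrix.star_eq_conjTranspose, Matrix.conjTranspose_eq_transpose_of_trivial,
        Function.comp_def] using this
  have key : ∀ a b : n → ℝ, (U * Matrix.diagonal a * Uᵀ) * (U * Matrix.diagonal b * Uᵀ)
      = U * Matrix.diagonal (fun i => a i * b i) * Uᵀ := by
    intro a b
    calc _ = U * Matrix.diagonal a * (Uᵀ * U) * Matrix.diagonal b * Uᵀ := by
          simp only [Matrix.mul_assoc]
      _ = _ := by rw [hU, Matrix.mul_one, Matrix.mul_assoc U, Matrix.diagonal_mul_diagonal]
  have symm : ∀ a : n → ℝ, (U * Matrix.diagonal a * Uᵀ)ᵀ = U * Matrix.diagonal a * Uᵀ := by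
    intro a
    simp [Matrix.transpose_mul, Matrix.mul_assoc]
  refine ⟨U * Matrix.diagonal (fun i => (d i)⁻¹) * Uᵀ, symm _, ?_, ?_, ?_, ?_⟩
  · rw [hd, key, key]
    congr 3; ext i
    by_cases h : d i = 0 <;> simp [h]
  · rw [hd, key, key]
    congr 3; ext i
    by_cases h : d i = 0 <;> simp [h]
  · rw [hd, key, symm]
  · rw [hd, key, symm]

theorem exists_isMoorePenrose {m n : Type*} [Fintype m] [Fintype n] (A : Matrix m n ℝ) :
    ∃ B : Matrix n m ℝ, IsMoorePenrose A B := by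
  classical
  obtain ⟨T, hT, h1, h2, h3, h4⟩ := exists_isMoorePenrose_of_symm (Aᵀ * A)
    (by simpa [Matrix.conjTranspose_eq_transpose_of_trivial] using
      Matrix.isHermitian_conjTranspose_mul_self A)
  have h5 : A * T * Aᵀ * A = A := by
    have h0 : (A * T * Aᵀ * A - A)ᴴ * (A * T * Aᵀ * A - A) = 0 := by
      have e : Aᵀ * (A * T * Aᵀ * A - A) = 0 := by
        rw [Matrix.mul_sub, sub_eq_zero]
        simpa only [Matrix.mul_assoc] using h1
      rw [Matrix.conjTranspose_eq_transpose_of_trivial, Matrix.transpose_sub, Matrix.sub_mul]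
      simp only [Matrix.transpose_mul, Matrix.transpose_transpose, Matrix.mul_assoc] at e ⊢
      rw [e]; simp
    exact sub_eq_zero.1 (Matrix.conjTranspose_mul_self_eq_zero.1 h0)
  refine ⟨T * Aᵀ, ?_, ?_, ?_, ?_⟩
  · simpa only [Matrix.mul_assoc] using h5
  · rw [Matrix.mul_assoc T Aᵀ A, ← Matrix.mul_assoc _ T Aᵀ, h2]
  · simp [Matrix.transpose_mul, hT, Matrix.mul_assoc]
  · rw [Matrix.mul_assoc, h4]

/-- The Moore–Penrose pseudo-inverse `A⁺` of a real matrix. -/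
noncomputable def pinv {m n : Type*} [Fintype m] [Fintype n] (A : Matrix m n ℝ) : Matrix n m ℝ :=
  (exists_isMoorePenrose A).choose

theorem pinv_spec {m n : Type*} [Fintype m] [Fintype n] (A : Matrix m n ℝ) :
    IsMoorePenrose A (pinv A) :=
  (exists_isMoorePenrose A).choose_spec

/-! ### Kernels and their integral operators -/

/-- `k` is a measurable (symmetric) positive semi-definite kernel whose diagonal is
`μ`-integrable. -/
structure IsIntegrableKernel {E : Type*} [MeasurableSpace E] (k : E → E → ℝ) (μ : Measure E) :
    Prop where
  posSemidef : (Matrix.of k).PosSemidef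
  measurable : Measurable (Function.uncurry k)
  integrable_diag : Integrable (fun x => k x x) μ

namespace IsIntegrableKernel

variable {E : Type*} [MeasurableSpace E] {k : E → E → ℝ} {μ : Measure E}

theorem diag_nonneg (hk : IsIntegrableKernel k μ) (x : E) : 0 ≤ k x x :=
  hk.posSemidef.diag_nonneg (i := x)

theorem abs_le (hk : IsIntegrableKernel k μ) (x y : E) :
    |k x y| ≤ √(k x x) * √(k y y) := by
  have h := (hk.posSemidef.submatrix ![x, y]).det_nonneg
  have hs : k y x = k x y := by simpa using hk.posSemidef.isHermitian.apply x y
  rw [Matrix.det_fin_two] at h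
  simp only [Matrix.submatrix_apply, Matrix.of_apply, Matrix.cons_val_zero,
    Matrix.cons_val_one] at h
  rw [hs] at h
  rw [← Real.sqrt_mul (hk.diag_nonneg x)]
  exact Real.abs_le_sqrt (by nlinarith)

theorem memLp_sqrt_diag (hk : IsIntegrableKernel k μ) : MemLp (fun x => √(k x x)) 2 μ := by
  have hm : Measurable fun x => √(k x x) :=
    (hk.measurable.comp (measurable_id.prodMk measurable_id)).sqrt
  rw [memLp_two_iff_integrable_sq hm.aestronglyMeasurable]
  exact hk.integrable_diag.congr (ae_of_all _ fun x => (Real.sq_sqrt (hk.diag_nonneg x)).symm)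

theorem integrable_sqrt_mul (hk : IsIntegrableKernel k μ) (f : Lp ℝ 2 μ) :
    Integrable (fun y => √(k y y) * |f y|) μ :=
  hk.memLp_sqrt_diag.integrable_mul (Lp.memLp f).abs

theorem integrable_mul (hk : IsIntegrableKernel k μ) (f : Lp ℝ 2 μ) (x : E) :
    Integrable (fun y => k x y * f y) μ := by
  refine ((hk.integrable_sqrt_mul f).const_mul √(k x x)).mono' ?_ (ae_of_all _ fun y => ?_)
  · exact ((hk.measurable.comp measurable_prodMk_left).aestronglyMeasurable).mul
      (Lp.aestronglyMeasurable f)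
  · rw [norm_mul, Real.norm_eq_abs, Real.norm_eq_abs, ← mul_assoc]
    exact mul_le_mul_of_nonneg_right (hk.abs_le x y) (abs_nonneg _)

theorem abs_integral_le (hk : IsIntegrableKernel k μ) (f : Lp ℝ 2 μ) (x : E) :
    |∫ y, k x y * f y ∂μ| ≤ (∫ y, √(k y y) * |f y| ∂μ) * √(k x x) := by
  rw [mul_comm, ← integral_const_mul, ← Real.norm_eq_abs]
  refine norm_integral_le_of_norm_le ((hk.integrable_sqrt_mul f).const_mul √(k x x))
    (ae_of_all _ fun y => ?_)
  rw [norm_mul, Real.norm_eq_abs, Real.norm_eq_abs, ← mul_assoc]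
  exact mul_le_mul_of_nonneg_right (hk.abs_le x y) (abs_nonneg _)

theorem memLp_integral [SFinite μ] (hk : IsIntegrableKernel k μ) (f : Lp ℝ 2 μ) :
    MemLp (fun x => ∫ y, k x y * f y ∂μ) 2 μ := by
  refine hk.memLp_sqrt_diag.of_le_mul (c := ∫ y, √(k y y) * |f y| ∂μ) ?_ (ae_of_all _ fun x => ?_)
  · have : StronglyMeasurable (Function.uncurry fun x y => k x y * f y) :=
      hk.measurable.stronglyMeasurable.mul ((Lp.stronglyMeasurable f).comp_measurable measurable_snd)
    exact this.integral_prod_right.aestronglyMeasurable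
  · rw [Real.norm_eq_abs, Real.norm_of_nonneg (Real.sqrt_nonneg _)]
    exact hk.abs_integral_le f x

theorem integral_sqrt_mul_le (hk : IsIntegrableKernel k μ) (f : Lp ℝ 2 μ) :
    ∫ y, √(k y y) * |f y| ∂μ ≤ ‖hk.memLp_sqrt_diag.toLp‖ * ‖f‖ := by
  have h := real_inner_le_norm (hk.memLp_sqrt_diag.toLp) |f|
  rw [norm_abs_eq_norm, L2.inner_def] at h
  refine le_trans (le_of_eq (integral_congr_ae ?_)) h
  filter_upwards [hk.memLp_sqrt_diag.coeFn_toLp, Lp.coeFn_abs f] with y h1 h2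
  rw [h1, h2]
  simp [mul_comm]

/-- The integral operator `𝒦 : L²(μ) → L²(μ)`, `(𝒦 f)(x) = ∫ k(x, y) f(y) dμ(y)`. -/
noncomputable def integralOperator [SFinite μ] (hk : IsIntegrableKernel k μ) :
    Lp ℝ 2 μ →L[ℝ] Lp ℝ 2 μ :=
  LinearMap.mkContinuous
    { toFun := fun f => (hk.memLp_integral f).toLp
      map_add' := fun f g => by
        rw [← MemLp.toLp_add, MemLp.toLp_eq_toLp_iff]
        refine ae_of_all _ fun x => ?_
        simp only [Pi.add_apply]
        rw [← integral_add (hk.integrable_mul f x) (hk.integrable_mul g x)]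
        refine integral_congr_ae ?_
        filter_upwards [Lp.coeFn_add f g] with y hy
        rw [hy, Pi.add_apply, mul_add]
      map_smul' := fun c f => by
        rw [RingHom.id_apply, ← MemLp.toLp_const_smul, MemLp.toLp_eq_toLp_iff]
        refine ae_of_all _ fun x => ?_
        simp only [Pi.smul_apply, smul_eq_mul]
        rw [← integral_const_mul]
        refine integral_congr_ae ?_
        filter_upwards [Lp.coeFn_smul c f] with y hy
        rw [hy, Pi.smul_apply, smul_eq_mul]
        ring }
    (‖hk.memLp_sqrt_diag.toLp‖ * ‖hk.memLp_sqrt_diag.toLp‖) fun f => by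
      refine (Lp.norm_le_mul_norm_of_ae_le_mul (g := hk.memLp_sqrt_diag.toLp)
        (c := ∫ y, √(k y y) * |f y| ∂μ) ?_).trans ?_
      · filter_upwards [(hk.memLp_integral f).coeFn_toLp, hk.memLp_sqrt_diag.coeFn_toLp]
          with x h1 h2
        simp only [LinearMap.coe_mk, AddHom.coe_mk]
        rw [h1, h2, Real.norm_eq_abs, Real.norm_of_nonneg (Real.sqrt_nonneg _)]
        exact hk.abs_integral_le f x
      · calc _ ≤ (‖hk.memLp_sqrt_diag.toLp‖ * ‖f‖) * ‖hk.memLp_sqrt_diag.toLp‖ :=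
            mul_le_mul_of_nonneg_right (hk.integral_sqrt_mul_le f) (norm_nonneg _)
          _ = _ := by ring

theorem integralOperator_ae [SFinite μ] (hk : IsIntegrableKernel k μ) (f : Lp ℝ 2 μ) :
    hk.integralOperator f =ᵐ[μ] fun x => ∫ y, k x y * f y ∂μ :=
  (hk.memLp_integral f).coeFn_toLp

end IsIntegrableKernel

/-- `σ 0 ≥ σ 1 ≥ ⋯ ≥ 0` is the non-increasing enumeration of the nonzero eigenvalues of the
(compact, positive) operator `T`, every nonzero eigenvalue being repeated according to its
multiplicity; the sequence is padded with zeros if there are only finitely many of them. -/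
structure IsEigenvalueSeq {H : Type*} [NormedAddCommGroup H] [NormedSpace ℝ H]
    (T : H →L[ℝ] H) (σ : ℕ → ℝ) : Prop where
  antitone : Antitone σ
  tendsto_zero : Tendsto σ atTop (𝓝 0)
  multiplicity : ∀ r : ℝ, r ≠ 0 → {i | σ i = r}.encard =
    Cardinal.toENat (Module.rank ℝ (Module.End.eigenspace (T : H →ₗ[ℝ] H) r))

/-! ### Nyström kernels -/

section Kernels

variable {E : Type*} {l : ℕ}

/-- The Gram matrix `k(Z, Z)`. -/
def gram (k : E → E → ℝ) (Z : Fin l → E) : Matrix (Fin l) (Fin l) ℝ :=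
  Matrix.of fun i j => k (Z i) (Z j)

/-- The column vector `k(Z, x)`. -/
def kvec (k : E → E → ℝ) (Z : Fin l → E) (x : E) : Fin l → ℝ := fun i => k (Z i) x

/-- `k^Z(x, y) = k(x, Z) k(Z, Z)⁺ k(Z, y)`. -/
noncomputable def nystromKernel (k : E → E → ℝ) (Z : Fin l → E) (x y : E) : ℝ :=
  (fun i => k x (Z i)) ⬝ᵥ (pinv (gram k Z) *ᵥ kvec k Z y)

variable [MeasurableSpace E]

/-- `ν(h) = ∫ h(x, x) dν(x)`. -/
noncomputable def diagIntegral (ν : Measure E) (h : E → E → ℝ) : ℝ := ∫ x, h x x ∂ν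

/-- The equally weighted empirical measure `μ_X = (1/M) ∑ⱼ δ_{xⱼ}`. -/
noncomputable def empiricalMeasure {M : ℕ} (X : Fin M → E) : Measure E :=
  (M : ℝ≥0∞)⁻¹ • ∑ j, Measure.dirac (X j)

/-- `h_ν(x, y) = ∫ k(x, t) k(t, y) dν(t)`. -/
noncomputable def squareKernel (k : E → E → ℝ) (ν : Measure E) (x y : E) : ℝ :=
  ∫ t, k x t * k t y ∂ν

/-- The matrices from which the Mercer decomposition of `k^Z` with respect to `ν` is computed:
some factorization `h_ν(Z, Z) = Hᵀ H` and some singular value decomposition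
`H k(Z, Z)⁺ Hᵀ = V diag(κ₁, …, κ_ℓ) Vᵀ` with `V` orthogonal and `κ₁ ≥ ⋯ ≥ κ_ℓ ≥ 0`. -/
structure MercerData (k : E → E → ℝ) (Z : Fin l → E) (ν : Measure E) where
  H : Matrix (Fin l) (Fin l) ℝ
  V : Matrix (Fin l) (Fin l) ℝ
  κ : Fin l → ℝ
  factor : Hᵀ * H = gram (squareKernel k ν) Z
  orthogonal : V ∈ Matrix.orthogonalGroup (Fin l) ℝ
  antitone : Antitone κ
  nonneg : ∀ i, 0 ≤ κ i
  svd : H * pinv (gram k Z) * Hᵀ = V * Matrix.diagonal κ * Vᵀ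

namespace MercerData

variable {k : E → E → ℝ} {Z : Fin l → E} {ν : Measure E}

/-- `f_i = (H⁺ v_i)ᵀ k(Z, ·)`, where `v_i` is the `i`-th column of `V`. -/
noncomputable def f (D : MercerData k Z ν) (i : Fin l) (x : E) : ℝ :=
  (pinv D.H *ᵥ D.V.col i) ⬝ᵥ kvec k Z x

/-- `k_ν^Z(x, y) = ∑_{i=1}^ℓ κ_i f_i(x) f_i(y)`. -/
noncomputable def kernel (D : MercerData k Z ν) (x y : E) : ℝ :=
  ∑ i, D.κ i * D.f i x * D.f i y

/-- `k_{s,ν}^Z(x, y) = ∑_{i=1}^s κ_i f_i(x) f_i(y)`, the first `s` terms of `k_ν^Z`. -/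
noncomputable def truncKernel (D : MercerData k Z ν) (s : ℕ) (x y : E) : ℝ :=
  ∑ i : Fin l, if (i : ℕ) < s then D.κ i * D.f i x * D.f i y else 0

end MercerData

end Kernels

end Nystrom

/-!
Let `Φ` be a feature map of `k`, `A : v ↦ ⟪Φ ·, v⟫` its feature operator into `L²(μ)`, so that
`𝒦 = A A*`, and write `k(Z, Z)⁺ = C Cᵀ`. By the choice of `H` and `V`, both random variables equal
the tail `∑_{i > s} κ_i`, the sum of the smallest `ℓ - s` eigenvalues of `Cᵀ h_X(Z, Z) C`. By Ky
Fan's principle this is the least partial trace of `Cᵀ h_X(Z, Z) C` over all orthonormal bases,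
hence measurable in `X`, and at most the partial trace in any fixed basis. The latter is linear in
`μ_X`, so its expectation is the same expression for `μ`, namely `∑_{i > s} ‖A p_i‖²` for some
vectors `p_i` in the span of the `Φ(z_j)` that satisfy Bessel's inequality. Gram–Schmidt provides a
basis for which the `p_i` with `i > s` are orthogonal to the first `s` right singular vectors of
`A`, and then the sum is at most `∑_{i > s} σ_i`.
-/

namespace Nystrom

section Hilbert

variable {F H : Type*} [NormedAddCommGroup F] [InnerProductSpace ℝ F]
  [NormedAddCommGroup H] [InnerProductSpace ℝ H]

theorem exists_norm_apply_le_of_mem_orthogonal {A : F →L[ℝ] H} {C : ℝ}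
    (hA : ∀ (n : ℕ) (e : Fin n → F), Orthonormal ℝ e → ∑ i, ‖A (e i)‖ ^ 2 ≤ C)
    {ε : ℝ} (hε : 0 < ε) :
    ∃ W : Submodule ℝ F, FiniteDimensional ℝ W ∧ ∀ x ∈ Wᗮ, ‖A x‖ ≤ ε * ‖x‖ := by
  -- A nearly maximal orthonormal family spans `W`: a unit vector orthogonal to `W` extends it.
  let S : Set ℝ := {r | ∃ (n : ℕ) (e : Fin n → F), Orthonormal ℝ e ∧ r = ∑ i, ‖A (e i)‖ ^ 2}
  have hS : BddAbove S := ⟨C, by rintro _ ⟨n, e, he, rfl⟩; exact hA n e he⟩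
  have hS₀ : S.Nonempty := ⟨_, 0, ![], .of_isEmpty ![], rfl⟩
  obtain ⟨_, ⟨n, e, he, rfl⟩, hlt⟩ :=
    exists_lt_of_lt_csSup hS₀ (sub_lt_self (sSup S) (pow_pos hε 2))
  refine ⟨Submodule.span ℝ (Set.range e), .span_of_finite ℝ (Set.finite_range e), fun x hx => ?_⟩
  rcases eq_or_ne x 0 with rfl | hx₀
  · simp
  have horth : ∀ i, inner ℝ x (e i) = 0 := fun i => by
    rw [real_inner_comm]; exact hx _ (Submodule.subset_span ⟨i, rfl⟩)
  have hcons : Orthonormal ℝ (Matrix.vecCons (‖x‖⁻¹ • x) e) :=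
    orthonormal_vecCons_iff.2
      ⟨by simpa using norm_smul_inv_norm (𝕜 := ℝ) hx₀,
        fun i => by rw [real_inner_smul_left, horth, mul_zero], he⟩
  have hsup : ‖A (‖x‖⁻¹ • x)‖ ^ 2 + ∑ i, ‖A (e i)‖ ^ 2 ≤ sSup S := by
    refine le_csSup hS ⟨n + 1, _, hcons, ?_⟩
    rw [Fin.sum_univ_succ]
    rfl
  have hunit : ‖A (‖x‖⁻¹ • x)‖ ≤ ε := le_of_sq_le_sq (by linarith) hε.le
  rwa [map_smul, norm_smul, norm_inv, norm_norm, inv_mul_le_iff₀' (norm_pos_iff.2 hx₀)] at hunit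

theorem isCompactOperator_of_sum_norm_sq_le [CompleteSpace H] {A : F →L[ℝ] H} {C : ℝ}
    (hA : ∀ (n : ℕ) (e : Fin n → F), Orthonormal ℝ e → ∑ i, ‖A (e i)‖ ^ 2 ≤ C) :
    IsCompactOperator A := by
  suffices A ∈ closure {B : F →L[ℝ] H | IsCompactOperator B} by
    rwa [isClosed_setOfPred_isCompactOperator.closure_eq] at this
  refine Metric.mem_closure_iff.2 fun ε hε => ?_
  obtain ⟨W, hW, hAW⟩ := exists_norm_apply_le_of_mem_orthogonal hA (half_pos hε)
  refine ⟨A ∘L W.starProjection, ?_, ?_⟩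
  · have hid : IsCompactOperator (id : W → W) := isCompactOperator_id_iff_finiteDimensional.2 hW
    exact (hid.clm_comp (A ∘L W.subtypeL)).comp_clm W.orthogonalProjectionOnto
  · rw [dist_eq_norm]
    refine (ContinuousLinearMap.opNorm_le_bound _ (half_pos hε).le fun x => ?_).trans_lt
      (half_lt_self hε)
    calc ‖(A - A ∘L W.starProjection) x‖ = ‖A (Wᗮ.starProjection x)‖ := by
          simp [Submodule.starProjection_orthogonal']
      _ ≤ ε / 2 * ‖Wᗮ.starProjection x‖ := hAW _ (Submodule.starProjection_apply_mem _ x)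
      _ ≤ ε / 2 * ‖x‖ := by gcongr; exact Wᗮ.norm_starProjection_apply_le x

theorem hasSum_inner_sq_of_forall_inner_eq_zero [CompleteSpace H] {ι : Type*} {e : ι → H}
    (he : Orthonormal ℝ e) {y : H} (hy : ∀ x, (∀ i, inner ℝ (e i) x = 0) → inner ℝ x y = 0) :
    HasSum (fun i => inner ℝ (e i) y ^ 2) (‖y‖ ^ 2) := by
  obtain ⟨w, b, hw, hb⟩ := he.toSubtypeRange.exists_hilbertBasis_extension
  have hsum : HasSum (fun x : w => inner ℝ (x : H) y ^ 2) (‖y‖ ^ 2) := by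
    rw [← real_inner_self_eq_norm_sq]
    refine (b.hasSum_inner_mul_inner y y).congr_fun fun x => ?_
    rw [hb, real_inner_comm, sq]
  have hinj : Function.Injective (fun i => (⟨e i, hw ⟨i, rfl⟩⟩ : w)) := fun i j hij =>
    he.linearIndependent.injective (congrArg Subtype.val hij)
  refine (hinj.hasSum_iff fun x hx => ?_).2 hsum
  have horth : ∀ i, inner ℝ (e i) (x : H) = 0 := fun i => by
    simpa only [hb] using b.orthonormal.inner_eq_zero (i := ⟨e i, hw ⟨i, rfl⟩⟩) fun h => hx ⟨i, h⟩
  rw [hy _ horth, sq, mul_zero]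

theorem sum_norm_sq_le_tsum_of_inner_eq_zero {A : F →L[ℝ] H} {σ : ℕ → ℝ}
    (hσ₀ : ∀ i, 0 ≤ σ i) (hσ : Summable σ) {v : ℕ → F}
    (hv : Orthonormal ℝ (fun i : {i // σ i ≠ 0} => v i))
    (hAv : ∀ w, HasSum (fun i => σ i * inner ℝ (v i) w ^ 2) (‖A w‖ ^ 2))
    {ι : Type*} {t : Finset ι} {p : ι → F} (hp : ∀ u, ∑ a ∈ t, inner ℝ u (p a) ^ 2 ≤ ‖u‖ ^ 2)
    {s : ℕ} (hvp : ∀ a ∈ t, ∀ i < s, inner ℝ (v i) (p a) = 0) :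
    ∑ a ∈ t, ‖A (p a)‖ ^ 2 ≤ ∑' i, σ (i + s) := by
  have hsum : HasSum (fun i => σ i * ∑ a ∈ t, inner ℝ (v i) (p a) ^ 2)
      (∑ a ∈ t, ‖A (p a)‖ ^ 2) := by
    simpa only [Finset.mul_sum] using hasSum_sum fun a _ => hAv (p a)
  have hhead : ∑ i ∈ Finset.range s, σ i * ∑ a ∈ t, inner ℝ (v i) (p a) ^ 2 = 0 :=
    Finset.sum_eq_zero fun i hi => by
      rw [Finset.sum_eq_zero fun a ha => by
        rw [hvp a ha i (Finset.mem_range.1 hi), zero_pow two_ne_zero], mul_zero]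
  have hle (i : ℕ) : σ i * ∑ a ∈ t, inner ℝ (v i) (p a) ^ 2 ≤ σ i := by
    by_cases hi : σ i = 0
    · rw [hi, zero_mul]
    · refine mul_le_of_le_one_right (hσ₀ i) ((hp (v i)).trans ?_)
      rw [hv.norm_eq_one ⟨i, hi⟩, one_pow]
  rw [← hsum.tsum_eq, ← hsum.summable.sum_add_tsum_nat_add s, hhead, zero_add]
  exact ((summable_nat_add_iff s).2 hsum.summable).tsum_le_tsum (fun i => hle (i + s))
    ((summable_nat_add_iff s).2 hσ)

theorem IsEigenvalueSeq.nonneg {T : H →L[ℝ] H} {σ : ℕ → ℝ} (hσ : IsEigenvalueSeq T σ) (i : ℕ) :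
    0 ≤ σ i :=
  hσ.antitone.le_of_tendsto hσ.tendsto_zero i

variable [CompleteSpace H]

theorem IsEigenvalueSeq.exists_orthonormal_span_eq_top {T : H →L[ℝ] H} {σ : ℕ → ℝ}
    (hσ : IsEigenvalueSeq T σ) (hT : IsCompactOperator T) {r : ℝ} (hr : r ≠ 0) :
    ∃ b : {i // σ i = r} → Module.End.eigenspace (T : H →ₗ[ℝ] H) r,
      Orthonormal ℝ b ∧ Submodule.span ℝ (Set.range b) = ⊤ := by
  have := ContinuousLinearMap.finite_dimensional_eigenspace hT r hr
  have hmult := hσ.multiplicity r hr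
  rw [← Module.finrank_eq_rank, Cardinal.toENat_nat] at hmult
  have : Finite {i // σ i = r} := (Set.finite_of_encard_eq_coe hmult).to_subtype
  have := Fintype.ofFinite {i // σ i = r}
  have hcard : Nat.card {i // σ i = r} =
      Module.finrank ℝ (Module.End.eigenspace (T : H →ₗ[ℝ] H) r) :=
    (Nat.card_coe_set_eq {i | σ i = r}).trans <| by rw [Set.ncard, hmult, ENat.toNat_natCast]
  let b := (stdOrthonormalBasis ℝ (Module.End.eigenspace (T : H →ₗ[ℝ] H) r)).reindex
    (Finite.equivFinOfCardEq hcard).symm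
  exact ⟨b, b.orthonormal, b.coe_toBasis ▸ b.toBasis.span_eq⟩

theorem IsEigenvalueSeq.exists_orthonormal_eigenvectors {T : H →L[ℝ] H} {σ : ℕ → ℝ}
    (hσ : IsEigenvalueSeq T σ) (hT : IsCompactOperator T)
    (hs : (T : H →ₗ[ℝ] H).IsSymmetric) :
    ∃ u : {i // σ i ≠ 0} → H, Orthonormal ℝ u ∧ (∀ i, T (u i) = σ i • u i) ∧
      ∀ x, (∀ i, inner ℝ (u i) x = 0) → T x = 0 := by
  choose b hb hspan using fun r : {r : ℝ // r ≠ 0} => hσ.exists_orthonormal_span_eq_top hT r.2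
  let ι : {i // σ i ≠ 0} → Σ r : {r : ℝ // r ≠ 0}, {i // σ i = r} :=
    fun i => ⟨⟨σ i, i.2⟩, ⟨i, rfl⟩⟩
  have hι : Function.Injective ι := Function.LeftInverse.injective
    (g := fun a => ⟨a.2.1, a.2.2.symm ▸ a.1.2⟩) fun _ => rfl
  refine ⟨fun i => b (ι i).1 (ι i).2, ?_, fun i => ?_, fun x hx => ?_⟩
  · exact ((hs.orthogonalFamily_eigenspaces.comp
      Subtype.val_injective).orthonormal_sigma_orthonormal hb).comp ι hι
  · exact Module.End.mem_eigenspace_iff.1 (b (ι i).1 (ι i).2).2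
  · have horth (r : ℝ) (hr : r ≠ 0) (y : Module.End.eigenspace (T : H →ₗ[ℝ] H) r) :
        inner ℝ (y : H) x = 0 := by
      have hy : y ∈ Submodule.span ℝ (Set.range (b ⟨r, hr⟩)) := hspan ⟨r, hr⟩ ▸ trivial
      induction hy using Submodule.span_induction with
      | mem y hy =>
        obtain ⟨⟨i, hi⟩, rfl⟩ := hy
        obtain rfl : σ i = r := hi
        exact hx ⟨i, hr⟩
      | zero => exact inner_zero_left x
      | add y z _ _ hy hz => rw [Submodule.coe_add, inner_add_left, hy, hz, add_zero]
      | smul c y _ hy => rw [Submodule.coe_smul, real_inner_smul_left, hy, mul_zero]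
    have hTx : T x ∈ (⨆ r, Module.End.eigenspace (T : H →ₗ[ℝ] H) r)ᗮ := by
      rw [← Submodule.iInf_orthogonal, Submodule.mem_iInf]
      intro r y hy
      have hsymm : inner ℝ y (T x) = r * inner ℝ y x := by
        rw [← real_inner_smul_left, ← Module.End.mem_eigenspace_iff.1 hy]
        exact (hs y x).symm
      rcases eq_or_ne r 0 with rfl | hr
      · rw [hsymm, zero_mul]
      · rw [hsymm, horth r hr ⟨y, hy⟩, mul_zero]
    rwa [ContinuousLinearMap.orthogonalComplement_iSup_eigenspaces_eq_bot hT hs] at hTx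

variable [CompleteSpace F] {A : F →L[ℝ] H} {σ : ℕ → ℝ}

theorem IsEigenvalueSeq.exists_singular_vectors
    (hσ : IsEigenvalueSeq (A ∘L A.adjoint) σ) (hA : IsCompactOperator A) :
    ∃ v : ℕ → F, Orthonormal ℝ (fun i : {i // σ i ≠ 0} => v i) ∧
      ∀ w, HasSum (fun i => σ i * inner ℝ (v i) w ^ 2) (‖A w‖ ^ 2) := by
  have hs : ((A ∘L A.adjoint : H →L[ℝ] H) : H →ₗ[ℝ] H).IsSymmetric := fun x y => by
    simp [← A.adjoint_inner_left, ← A.adjoint_inner_right]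
  obtain ⟨u, hu, hAu, hker⟩ := hσ.exists_orthonormal_eigenvectors (hA.comp_clm A.adjoint) hs
  let v : {i // σ i ≠ 0} → F := fun i => (√(σ i))⁻¹ • A.adjoint (u i)
  have hsqrt (i : {i // σ i ≠ 0}) : √(σ i) ≠ 0 :=
    (Real.sqrt_pos.2 ((hσ.nonneg i).lt_of_ne' i.2)).ne'
  have hinner (i : {i // σ i ≠ 0}) (w : F) : inner ℝ (u i) (A w) = √(σ i) * inner ℝ (v i) w := by
    rw [real_inner_smul_left, A.adjoint_inner_left, mul_inv_cancel_left₀ (hsqrt i)]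
  have hAv (i : {i // σ i ≠ 0}) : A (v i) = √(σ i) • u i := by
    rw [map_smul, ← A.comp_apply, hAu, smul_smul, inv_mul_eq_div, Real.div_sqrt]
  have hv : Orthonormal ℝ v := by
    classical
    refine orthonormal_iff_ite.2 fun i j => mul_left_cancel₀ (hsqrt i) ?_
    rw [← hinner, hAv, real_inner_smul_right, orthonormal_iff_ite.1 hu]
    split_ifs with h
    · rw [h]
    · rw [mul_zero, mul_zero]
  have hparseval (w : F) : HasSum (fun i => inner ℝ (u i) (A w) ^ 2) (‖A w‖ ^ 2) := by
    refine hasSum_inner_sq_of_forall_inner_eq_zero hu fun x hx => ?_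
    have hAx : A.adjoint x = 0 := by
      rw [← inner_self_eq_zero (𝕜 := ℝ), A.adjoint_inner_left, ← A.comp_apply, hker x hx,
        inner_zero_right]
    rw [← A.adjoint_inner_left, hAx, inner_zero_left]
  have hext (i : {i // σ i ≠ 0}) : Function.extend Subtype.val v 0 (i : ℕ) = v i :=
    Subtype.val_injective.extend_apply v 0 i
  refine ⟨Function.extend Subtype.val v 0, by simpa only [hext] using hv, fun w => ?_⟩
  refine (Subtype.val_injective.hasSum_iff fun i hi => ?_).1
    ((hparseval w).congr_fun fun i => ?_)
  · rw [by_contra fun h : ¬σ i = 0 => hi ⟨⟨i, h⟩, rfl⟩, zero_mul]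
  · rw [Function.comp_apply, hext i, hinner, mul_pow, Real.sq_sqrt (hσ.nonneg i)]

theorem IsEigenvalueSeq.summable_of_sum_norm_sq_le (hσ : IsEigenvalueSeq (A ∘L A.adjoint) σ)
    {C : ℝ} (hA : ∀ (n : ℕ) (e : Fin n → F), Orthonormal ℝ e → ∑ i, ‖A (e i)‖ ^ 2 ≤ C) :
    Summable σ := by
  obtain ⟨v, hv, hAv⟩ := hσ.exists_singular_vectors (isCompactOperator_of_sum_norm_sq_le hA)
  have hσv (i : {i // σ i ≠ 0}) : ‖A (v i)‖ ^ 2 = σ i := by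
    refine (hAv (v i)).unique (((hasSum_ite_eq (i : ℕ) (σ i))).congr_fun fun j => ?_)
    split_ifs with h
    · rw [h, real_inner_self_eq_norm_sq, hv.norm_eq_one i, one_pow, one_pow, mul_one]
    · by_cases hj : σ j = 0
      · rw [hj, zero_mul]
      · rw [hv.inner_eq_zero (i := ⟨j, hj⟩) (j := i) fun hij => h (congrArg Subtype.val hij),
          zero_pow two_ne_zero, mul_zero]
  refine (Subtype.val_injective.summable_iff (g := ((↑) : {i // σ i ≠ 0} → ℕ))
    fun i hi => by_contra fun h => hi ⟨⟨i, h⟩, rfl⟩).1 ?_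
  refine summable_of_sum_le (c := C) (fun i => hσ.nonneg i) fun s => ?_
  calc ∑ i ∈ s, σ i = ∑ j : Fin s.card, ‖A (v (s.equivFin.symm j).1)‖ ^ 2 := by
        rw [← s.sum_coe_sort, ← s.equivFin.symm.sum_comp]
        exact Finset.sum_congr rfl fun j _ => (hσv _).symm
    _ ≤ C := hA _ _ (hv.comp _ (Subtype.val_injective.comp s.equivFin.symm.injective))

end Hilbert

section FeatureMap

theorem exists_feature_map_of_posSemidef.{u} {E : Type u} {k : E → E → ℝ}
    (hk : (Matrix.of k).PosSemidef) :
    ∃ (F : Type u) (_ : NormedAddCommGroup F) (_ : InnerProductSpace ℝ F)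
      (_ : CompleteSpace F) (Φ : E → F), ∀ x y, inner ℝ (Φ x) (Φ y) = k x y := by
  let K : Matrix E E (ℝ →L[ℝ] ℝ) := .of fun x y => k x y • ContinuousLinearMap.id ℝ ℝ
  have hsymm (x y : E) : k y x = k x y := by simpa using hk.isHermitian.apply x y
  have hK : K.PosSemidef := by
    refine ((RKHS.posSemidef_tfae (K := K)).out 0 2).mpr ?_
    refine ⟨Matrix.ext fun x y => ?_, fun w => ?_⟩
    · simp only [Matrix.conjTranspose_apply, K, Matrix.of_apply, star_smul, star_trivial, hsymm,
        ContinuousLinearMap.star_eq_adjoint, ContinuousLinearMap.adjoint_id]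
    · rw [Finsupp.sum_comm]
      simpa [K, mul_comm, mul_left_comm] using hk.2 w
  have : Fact K.PosSemidef := ⟨hK⟩
  refine ⟨RKHS.OfKernel K, inferInstance, inferInstance, inferInstance,
    fun x => RKHS.kerFun (RKHS.OfKernel K) x 1, fun x y => ?_⟩
  rw [← RKHS.kernel_inner, RKHS.OfKernel.kernel_ofKernel]
  simpa [K] using hsymm x y

/-- A feature map `Φ : E → F` that is weakly measurable and square integrable with respect to
`μ`. -/
structure IsL2FeatureMap {E F : Type*} [MeasurableSpace E] [NormedAddCommGroup F]
    [InnerProductSpace ℝ F] (Φ : E → F) (μ : Measure E) : Prop where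
  aestronglyMeasurable_inner : ∀ v, AEStronglyMeasurable (fun x => inner ℝ (Φ x) v) μ
  integrable_norm_sq : Integrable (fun x => ‖Φ x‖ ^ 2) μ

theorem IsIntegrableKernel.isL2FeatureMap {E F : Type*} [MeasurableSpace E] {k : E → E → ℝ}
    {μ : Measure E} (hk : IsIntegrableKernel k μ) [NormedAddCommGroup F] [InnerProductSpace ℝ F]
    [CompleteSpace F] {Φ : E → F} (hΦ : ∀ x y, inner ℝ (Φ x) (Φ y) = k x y) :
    IsL2FeatureMap Φ μ where
  aestronglyMeasurable_inner v := by
    -- Only the projection of `v` to the closed span of the features matters, and on the span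
    -- itself the functions are finite combinations of sections of `k`.
    let W : Submodule ℝ F := (Submodule.span ℝ (Set.range Φ)).topologicalClosure
    have hΦW (x : E) : inner ℝ (Φ x) (W.starProjection v) = inner ℝ (Φ x) v := by
      rw [← W.inner_starProjection_left_eq_right, W.starProjection_eq_self_iff.2
        (subset_closure (Submodule.subset_span ⟨x, rfl⟩))]
    obtain ⟨w, hw, hlim⟩ := mem_closure_iff_seq_limit.1 (W.starProjection_apply_mem v)
    have hmeas (u : F) (hu : u ∈ Submodule.span ℝ (Set.range Φ)) :
        AEStronglyMeasurable (fun x => inner ℝ (Φ x) u) μ := by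
      induction hu using Submodule.span_induction with
      | mem u hu =>
        obtain ⟨y, rfl⟩ := hu
        simp only [hΦ]
        exact (hk.measurable.comp measurable_prodMk_right).aestronglyMeasurable
      | zero => simpa only [inner_zero_right] using aestronglyMeasurable_const
      | add u u' _ _ hu hu' => simp only [inner_add_right]; exact hu.add hu'
      | smul c u _ hu => simpa only [real_inner_smul_right] using hu.const_mul c
    simpa only [hΦW] using aestronglyMeasurable_of_tendsto_ae atTop (fun n => hmeas _ (hw n))
      (ae_of_all μ fun x => (tendsto_const_nhds (x := Φ x)).inner hlim)
  integrable_norm_sq := by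
    simpa only [← real_inner_self_eq_norm_sq, hΦ] using hk.integrable_diag

namespace IsL2FeatureMap

variable {E F : Type*} [MeasurableSpace E] [NormedAddCommGroup F] [InnerProductSpace ℝ F]
  {Φ : E → F} {μ : Measure E}

theorem memLp_inner (hΦ : IsL2FeatureMap Φ μ) (v : F) :
    MemLp (fun x => inner ℝ (Φ x) v) 2 μ := by
  refine (memLp_two_iff_integrable_sq (hΦ.aestronglyMeasurable_inner v)).2 <|
    (hΦ.integrable_norm_sq.mul_const (‖v‖ ^ 2)).mono'
      ((hΦ.aestronglyMeasurable_inner v).pow 2) (ae_of_all μ fun x => ?_)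
  rw [norm_pow, ← mul_pow]
  gcongr
  exact norm_inner_le_norm (Φ x) v

theorem norm_toLp_inner_sq (hΦ : IsL2FeatureMap Φ μ) (v : F) :
    ‖(hΦ.memLp_inner v).toLp‖ ^ 2 = ∫ x, inner ℝ (Φ x) v ^ 2 ∂μ := by
  rw [← real_inner_self_eq_norm_sq, L2.inner_def]
  refine integral_congr_ae ?_
  filter_upwards [(hΦ.memLp_inner v).coeFn_toLp] with x hx
  rw [hx, real_inner_self_eq_norm_sq, Real.norm_eq_abs, sq_abs]

/-- The feature operator `F → L²(μ)`, `v ↦ ⟪Φ ·, v⟫`, through which the integral operator of the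
kernel `⟪Φ x, Φ y⟫` factors. -/
noncomputable def operator (hΦ : IsL2FeatureMap Φ μ) : F →L[ℝ] Lp ℝ 2 μ :=
  LinearMap.mkContinuous
    { toFun := fun v => (hΦ.memLp_inner v).toLp
      map_add' := fun v w => by simp only [← MemLp.toLp_add, inner_add_right]; rfl
      map_smul' := fun c v => by
        simp only [← MemLp.toLp_const_smul, real_inner_smul_right]; rfl }
    √(∫ x, ‖Φ x‖ ^ 2 ∂μ) fun v => by
      refine le_of_sq_le_sq ?_ (by positivity)
      rw [mul_pow, Real.sq_sqrt (by positivity), ← integral_mul_const]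
      refine (hΦ.norm_toLp_inner_sq v).trans_le
        (integral_mono (hΦ.memLp_inner v).integrable_sq (hΦ.integrable_norm_sq.mul_const _)
          fun x => ?_)
      rw [← mul_pow, ← sq_abs]
      gcongr
      exact abs_real_inner_le_norm (Φ x) v

theorem operator_ae (hΦ : IsL2FeatureMap Φ μ) (v : F) :
    hΦ.operator v =ᵐ[μ] fun x => inner ℝ (Φ x) v :=
  (hΦ.memLp_inner v).coeFn_toLp

theorem norm_operator_sq (hΦ : IsL2FeatureMap Φ μ) (v : F) :
    ‖hΦ.operator v‖ ^ 2 = ∫ x, inner ℝ (Φ x) v ^ 2 ∂μ :=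
  hΦ.norm_toLp_inner_sq v

theorem sum_norm_operator_sq_le (hΦ : IsL2FeatureMap Φ μ) {ι : Type*} [Fintype ι] {e : ι → F}
    (he : Orthonormal ℝ e) : ∑ i, ‖hΦ.operator (e i)‖ ^ 2 ≤ ∫ x, ‖Φ x‖ ^ 2 ∂μ := by
  have hint (i : ι) : Integrable (fun x => inner ℝ (Φ x) (e i) ^ 2) μ :=
    (hΦ.memLp_inner (e i)).integrable_sq
  simp only [norm_operator_sq]
  rw [← integral_finsetSum _ fun i _ => hint i]
  refine integral_mono (integrable_finsetSum _ fun i _ => hint i) hΦ.integrable_norm_sq fun x => ?_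
  simpa only [Real.norm_eq_abs, sq_abs, real_inner_comm] using
    he.sum_inner_products_le (Φ x) (s := Finset.univ)

theorem operator_comp_adjoint [CompleteSpace F] [SFinite μ] (hΦ : IsL2FeatureMap Φ μ)
    {k : E → E → ℝ} (hk : IsIntegrableKernel k μ) (hΦk : ∀ x y, inner ℝ (Φ x) (Φ y) = k x y) :
    hΦ.operator ∘L hΦ.operator.adjoint = hk.integralOperator := by
  ext1 f
  refine Lp.ext ?_
  filter_upwards [hΦ.operator_ae (hΦ.operator.adjoint f), hk.integralOperator_ae f] with x hx hkx
  rw [ContinuousLinearMap.comp_apply, hx, hkx, ContinuousLinearMap.adjoint_inner_right,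
    L2.inner_def]
  refine integral_congr_ae ?_
  filter_upwards [hΦ.operator_ae (Φ x)] with y hy
  rw [hy, real_inner_comm (Φ x), hΦk, RCLike.inner_apply, conj_trivial, mul_comm]

end IsL2FeatureMap

end FeatureMap

section KyFan

variable {n : Type*} [Fintype n]

theorem sum_le_sum_mul_of_forall_le {t : Finset n} {κ p : n → ℝ}
    (hκ : ∀ i ∈ t, ∀ j ∉ t, κ i ≤ κ j) (hp₀ : ∀ i, 0 ≤ p i) (hp₁ : ∀ i, p i ≤ 1)
    (hp : ∑ i, p i = t.card) : ∑ i ∈ t, κ i ≤ ∑ i, κ i * p i := by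
  classical
  obtain ⟨c, hct, hc⟩ : ∃ c, (∀ i ∈ t, κ i ≤ c) ∧ ∀ j ∉ t, c ≤ κ j := by
    obtain rfl | ht := t.eq_empty_or_nonempty
    · obtain ⟨c, hc⟩ := (Set.finite_range κ).bddBelow
      exact ⟨c, by simp, fun j _ => hc ⟨j, rfl⟩⟩
    · exact ⟨t.sup' ht κ, fun i hi => t.le_sup' κ hi, fun j hj =>
        t.sup'_le ht κ fun i hi => hκ i hi j hj⟩
  have hle (i : n) : (κ i - c) * (if i ∈ t then 1 else 0) ≤ (κ i - c) * p i := by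
    split_ifs with hi
    · exact mul_le_mul_of_nonpos_left (hp₁ i) (sub_nonpos.2 (hct i hi))
    · simpa using mul_nonneg (sub_nonneg.2 (hc i hi)) (hp₀ i)
  have hsum := Finset.univ.sum_le_sum fun i _ => hle i
  simp only [mul_ite, mul_one, mul_zero, Finset.sum_ite_mem, Finset.univ_inter, sub_mul,
    Finset.sum_sub_distrib, ← Finset.mul_sum, hp, Finset.sum_const, nsmul_eq_mul] at hsum
  linarith

theorem continuous_uncurry_partial_trace (t : Finset n) :
    Continuous (Function.uncurry fun A W : Matrix n n ℝ => ∑ i ∈ t, (Wᵀ * A * W) i i) := by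
  have h : Continuous fun x : Matrix n n ℝ × Matrix n n ℝ => x.2ᵀ * x.1 * x.2 := by fun_prop
  exact continuous_finsetSum _ fun i _ => h.matrix_elem i i

variable [DecidableEq n]

theorem sum_sq_col_eq_one {Q : Matrix n n ℝ} (hQ : Q ∈ Matrix.orthogonalGroup n ℝ) (i : n) :
    ∑ j, Q j i ^ 2 = 1 := by
  have h := congrFun₂ ((Matrix.mem_orthogonalGroup_iff' n ℝ).1 hQ) i i
  simpa [Matrix.mul_apply, Matrix.star_apply, sq] using h

theorem sum_le_sum_transpose_mul_diagonal_mul {t : Finset n} {κ : n → ℝ}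
    (hκ : ∀ i ∈ t, ∀ j ∉ t, κ i ≤ κ j) {Q : Matrix n n ℝ}
    (hQ : Q ∈ Matrix.orthogonalGroup n ℝ) :
    ∑ i ∈ t, κ i ≤ ∑ i ∈ t, (Qᵀ * Matrix.diagonal κ * Q) i i := by
  have hrow (j : n) : ∑ i, Q j i ^ 2 = 1 := sum_sq_col_eq_one (Unitary.star_mem hQ) j
  calc ∑ i ∈ t, κ i ≤ ∑ j, κ j * ∑ i ∈ t, Q j i ^ 2 := by
        refine sum_le_sum_mul_of_forall_le hκ (fun j => by positivity) (fun j => ?_) ?_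
        · rw [← hrow j]
          exact Finset.sum_le_univ_sum_of_nonneg fun i => sq_nonneg _
        · rw [Finset.sum_comm]
          simp [sum_sq_col_eq_one hQ]
    _ = ∑ i ∈ t, (Qᵀ * Matrix.diagonal κ * Q) i i := by
        simp only [Finset.mul_sum, Matrix.mul_apply (M := _ * _), Matrix.mul_diagonal,
          Matrix.transpose_apply]
        rw [Finset.sum_comm]
        exact Finset.sum_congr rfl fun i _ => Finset.sum_congr rfl fun j _ => by ring

/-- The infimum over all orthonormal bases of the partial trace of `A` over the basis vectors with
index in `t`. For symmetric `A` it is the sum of the `#t` smallest eigenvalues, expressed without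
choosing a diagonalization, which makes its continuity in `A` visible. -/
noncomputable def partialTraceInf (t : Finset n) (A : Matrix n n ℝ) : ℝ :=
  sInf ((fun W : Matrix n n ℝ => ∑ i ∈ t, (Wᵀ * A * W) i i) '' Matrix.orthogonalGroup n ℝ)

theorem isCompact_orthogonalGroup :
    IsCompact (Matrix.orthogonalGroup n ℝ : Set (Matrix n n ℝ)) := by
  have hbox : IsCompact (Set.univ.pi fun _ : n => Set.univ.pi fun _ : n =>
      Metric.closedBall (0 : ℝ) 1) :=
    isCompact_univ_pi fun _ => isCompact_univ_pi fun _ => isCompact_closedBall _ _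
  refine hbox.of_isClosed_subset ?_ fun U hU i _ j _ => ?_
  · exact isClosed_unitary (R := Matrix n n ℝ)
  · simpa using entry_norm_bound_of_unitary hU i j

theorem continuous_partialTraceInf (t : Finset n) :
    Continuous (partialTraceInf t : Matrix n n ℝ → ℝ) :=
  isCompact_orthogonalGroup.continuous_sInf (continuous_uncurry_partial_trace t)

theorem partialTraceInf_le (t : Finset n) (A : Matrix n n ℝ) {W : Matrix n n ℝ}
    (hW : W ∈ Matrix.orthogonalGroup n ℝ) :
    partialTraceInf t A ≤ ∑ i ∈ t, (Wᵀ * A * W) i i :=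
  csInf_le (isCompact_orthogonalGroup.image ((continuous_uncurry_partial_trace t).comp
    (Continuous.prodMk_right A))).bddBelow ⟨W, hW, rfl⟩

theorem partialTraceInf_conj_diagonal {t : Finset n} {κ : n → ℝ}
    (hκ : ∀ i ∈ t, ∀ j ∉ t, κ i ≤ κ j) {U : Matrix n n ℝ}
    (hU : U ∈ Matrix.orthogonalGroup n ℝ) :
    partialTraceInf t (U * Matrix.diagonal κ * Uᵀ) = ∑ i ∈ t, κ i := by
  have hconj (W : Matrix n n ℝ) : Wᵀ * (U * Matrix.diagonal κ * Uᵀ) * W =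
      (Uᵀ * W)ᵀ * Matrix.diagonal κ * (Uᵀ * W) := by
    simp only [Matrix.transpose_mul, Matrix.transpose_transpose, Matrix.mul_assoc]
  refine IsLeast.csInf_eq ⟨⟨U, hU, ?_⟩, ?_⟩
  · have hUU : Uᵀ * U = 1 := (Matrix.mem_orthogonalGroup_iff' n ℝ).1 hU
    simp only [hconj, hUU, Matrix.transpose_one, Matrix.one_mul, Matrix.mul_one,
      Matrix.diagonal_apply_eq]
  · rintro _ ⟨W, hW, rfl⟩
    simp only [hconj]
    exact sum_le_sum_transpose_mul_diagonal_mul hκ (mul_mem (Unitary.star_mem hU) hW)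

theorem exists_eq_conj_of_charpoly_eq {A B : Matrix n n ℝ} (hA : A.IsHermitian)
    (hB : B.IsHermitian) (h : A.charpoly = B.charpoly) :
    ∃ Q ∈ Matrix.orthogonalGroup n ℝ, A = Q * B * Qᵀ := by
  have heig : hA.eigenvalues = hB.eigenvalues := (hA.eigenvalues_eq_eigenvalues_iff hB).2 h
  refine ⟨_, (hA.eigenvectorUnitary * star hB.eigenvectorUnitary).2, ?_⟩
  calc A = Unitary.conjStarAlgAut ℝ _ hA.eigenvectorUnitary
        (Matrix.diagonal (RCLike.ofReal ∘ hB.eigenvalues)) := heig ▸ hA.spectral_theorem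
    _ = Unitary.conjStarAlgAut ℝ _ (hA.eigenvectorUnitary * star hB.eigenvectorUnitary) B := by
      rw [Unitary.conjStarAlgAut_mul_apply, hB.conjStarAlgAut_star_eigenvectorUnitary]
    _ = _ := Unitary.conjStarAlgAut_apply _ B

theorem partialTraceInf_transpose_mul_self {t : Finset n} {κ : n → ℝ}
    (hκ : ∀ i ∈ t, ∀ j ∉ t, κ i ≤ κ j) {N V : Matrix n n ℝ}
    (hV : V ∈ Matrix.orthogonalGroup n ℝ) (hN : N * Nᵀ = V * Matrix.diagonal κ * Vᵀ) :
    partialTraceInf t (Nᵀ * N) = ∑ i ∈ t, κ i := by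
  obtain ⟨Q, hQ, hNQ⟩ := exists_eq_conj_of_charpoly_eq
    (Matrix.isHermitian_conjTranspose_mul_self N) (Matrix.isHermitian_mul_conjTranspose_self N)
    (Matrix.charpoly_mul_comm _ _)
  rw [← partialTraceInf_conj_diagonal hκ (mul_mem hQ hV)]
  congr 1
  simp only [Matrix.conjTranspose_eq_transpose_of_trivial, hN] at hNQ
  simp only [hNQ, Matrix.transpose_mul, Matrix.mul_assoc]

end KyFan

section Mercer

variable {E : Type*} [MeasurableSpace E] {k : E → E → ℝ} {μ : Measure E} {l : ℕ} {Z : Fin l → E}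

theorem posSemidef_pinv {n : Type*} [Fintype n] {S : Matrix n n ℝ} (hS : S.PosSemidef) :
    (pinv S).PosSemidef := by
  obtain ⟨T, hT, hST⟩ := exists_isMoorePenrose_of_symm S hS.isHermitian
  have hsymm : (pinv S)ᴴ = pinv S := by
    rw [(pinv_spec S).unique hST, Matrix.conjTranspose_eq_transpose_of_trivial, hT]
  have h := hS.mul_mul_conjTranspose_same (pinv S)
  rwa [hsymm, (pinv_spec S).self_mul_mul] at h

theorem isIdempotentElem_transpose_mul_mul {n : Type*} [Fintype n] {G B : Matrix n n ℝ}
    (hB : B * Bᵀ = pinv G) : IsIdempotentElem (Bᵀ * G * B) := by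
  calc Bᵀ * G * B * (Bᵀ * G * B) = Bᵀ * (G * (B * Bᵀ) * G) * B := by
        simp only [Matrix.mul_assoc]
    _ = Bᵀ * G * B := by rw [hB, (pinv_spec G).mul_mul_self]

open scoped MatrixOrder Matrix.Norms.L2Operator in
theorem exists_mul_transpose_self_eq {n : Type*} [Fintype n] {S : Matrix n n ℝ}
    (hS : S.PosSemidef) : ∃ C : Matrix n n ℝ, C * Cᵀ = S := by
  classical
  obtain ⟨C, hC⟩ := CStarAlgebra.nonneg_iff_eq_mul_star_self.1 hS.nonneg
  exact ⟨C, hC.symm⟩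

namespace IsIntegrableKernel

theorem symm (hk : IsIntegrableKernel k μ) (x y : E) : k x y = k y x := by
  simpa using hk.posSemidef.isHermitian.apply y x

theorem memLp_apply (hk : IsIntegrableKernel k μ) (y : E) : MemLp (k y) 2 μ := by
  refine hk.memLp_sqrt_diag.of_le_mul (c := √(k y y))
    (hk.measurable.comp measurable_prodMk_left).aestronglyMeasurable (ae_of_all μ fun x => ?_)
  rw [Real.norm_of_nonneg (Real.sqrt_nonneg _)]
  exact hk.abs_le y x

theorem memLp_dotProduct_kvec (hk : IsIntegrableKernel k μ) (c : Fin l → ℝ) :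
    MemLp (fun x => c ⬝ᵥ kvec k Z x) 2 μ :=
  memLp_finsetSum _ fun i _ => (hk.memLp_apply (Z i)).const_mul (c i)

theorem integrable_dotProduct_kvec_mul (hk : IsIntegrableKernel k μ) (c d : Fin l → ℝ) :
    Integrable (fun x => (c ⬝ᵥ kvec k Z x) * (d ⬝ᵥ kvec k Z x)) μ :=
  (hk.memLp_dotProduct_kvec c).integrable_mul (hk.memLp_dotProduct_kvec d)

theorem integral_dotProduct_kvec_mul (hk : IsIntegrableKernel k μ) (c d : Fin l → ℝ) :
    ∫ x, (c ⬝ᵥ kvec k Z x) * (d ⬝ᵥ kvec k Z x) ∂μ =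
      c ⬝ᵥ gram (squareKernel k μ) Z *ᵥ d := by
  have hint (i j : Fin l) : Integrable (fun x => c i * k (Z i) x * (d j * k (Z j) x)) μ :=
    ((hk.memLp_apply (Z i)).const_mul (c i)).integrable_mul
      ((hk.memLp_apply (Z j)).const_mul (d j))
  have hterm (i j : Fin l) : ∫ x, c i * k (Z i) x * (d j * k (Z j) x) ∂μ =
      c i * gram (squareKernel k μ) Z i j * d j := by
    rw [mul_right_comm, gram, Matrix.of_apply, squareKernel, ← integral_const_mul]
    refine integral_congr_ae (ae_of_all μ fun x => ?_)
    simp only [hk.symm x (Z j)]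
    ring
  rw [Matrix.dot_mulVec_eq_sum_sum, Finset.sum_comm]
  simp only [← hterm, dotProduct, kvec, Finset.sum_mul_sum]
  rw [integral_finsetSum _ fun i _ => integrable_finsetSum _ fun j _ => hint i j]
  exact Finset.sum_congr rfl fun i _ => integral_finsetSum _ fun j _ => hint i j

theorem nystromKernel_self (hk : IsIntegrableKernel k μ) (x : E) :
    nystromKernel k Z x x =
      ∑ i, ((pinv (gram k Z)).row i ⬝ᵥ kvec k Z x) * (Pi.single i 1 ⬝ᵥ kvec k Z x) := by
  simp only [nystromKernel, single_one_dotProduct, hk.symm x]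
  exact Finset.sum_congr rfl fun i _ => mul_comm _ _

theorem integrable_nystromKernel_self (hk : IsIntegrableKernel k μ) :
    Integrable (fun x => nystromKernel k Z x x) μ := by
  simp only [hk.nystromKernel_self]
  exact integrable_finsetSum _ fun i _ => hk.integrable_dotProduct_kvec_mul _ _

theorem diagIntegral_nystromKernel (hk : IsIntegrableKernel k μ) :
    diagIntegral μ (nystromKernel k Z) = (pinv (gram k Z) * gram (squareKernel k μ) Z).trace := by
  simp only [diagIntegral, hk.nystromKernel_self]
  rw [integral_finsetSum _ fun i _ => hk.integrable_dotProduct_kvec_mul _ _]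
  simp only [hk.integral_dotProduct_kvec_mul, Matrix.mulVec_single_one]
  rfl

end IsIntegrableKernel

theorem sum_sub_sum_lt (κ : Fin l → ℝ) (s : ℕ) :
    ∑ i, κ i - ∑ i ∈ {i : Fin l | (i : ℕ) < s}, κ i = ∑ i ∈ {i : Fin l | s ≤ (i : ℕ)}, κ i := by
  rw [sub_eq_iff_eq_add', ← Finset.sum_filter_add_sum_filter_not _ fun i : Fin l => (i : ℕ) < s]
  simp only [not_lt]

namespace MercerData

variable (D : MercerData k Z μ)

theorem trace_pinv_mul_gram_squareKernel :
    (pinv (gram k Z) * gram (squareKernel k μ) Z).trace = ∑ i, D.κ i := by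
  have hV : D.Vᵀ * D.V = 1 := (Matrix.mem_orthogonalGroup_iff' _ _).1 D.orthogonal
  rw [← D.factor, ← Matrix.mul_assoc, Matrix.trace_mul_comm, ← Matrix.mul_assoc, D.svd,
    Matrix.trace_mul_comm, ← Matrix.mul_assoc, hV, Matrix.one_mul, Matrix.trace_diagonal]

theorem svd_mulVec_col (i : Fin l) :
    (D.H * pinv (gram k Z) * D.Hᵀ) *ᵥ D.V.col i = D.κ i • D.V.col i := by
  have hV : D.Vᵀ * D.V = 1 := (Matrix.mem_orthogonalGroup_iff' _ _).1 D.orthogonal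
  rw [D.svd, ← Matrix.mulVec_single_one, Matrix.mulVec_mulVec, Matrix.mul_assoc, hV,
    Matrix.mul_one, ← Matrix.mulVec_mulVec, Matrix.diagonal_mulVec_single, ← Matrix.mulVec_smul,
    ← Pi.single_smul, smul_eq_mul]

theorem H_mulVec_pinv_mulVec_col {i : Fin l} (hi : D.κ i ≠ 0) :
    D.H *ᵥ (pinv D.H *ᵥ D.V.col i) = D.V.col i := by
  refine smul_right_injective _ hi ?_
  simp only [← Matrix.mulVec_smul, ← D.svd_mulVec_col, Matrix.mulVec_mulVec]
  simp only [← Matrix.mul_assoc, (pinv_spec D.H).mul_mul_self]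

theorem κ_mul_integral_f_mul_f (hk : IsIntegrableKernel k μ) (i : Fin l) :
    D.κ i * ∫ x, D.f i x * D.f i x ∂μ = D.κ i := by
  rcases eq_or_ne (D.κ i) 0 with hi | hi
  · rw [hi, zero_mul]
  have hV : D.V.col i ⬝ᵥ D.V.col i = 1 :=
    (congrFun₂ ((Matrix.mem_orthogonalGroup_iff' _ _).1 D.orthogonal) i i).trans
      (Matrix.one_apply_eq i)
  simp only [f, hk.integral_dotProduct_kvec_mul, ← D.factor]
  rw [← Matrix.mulVec_mulVec, Matrix.dotProduct_mulVec, Matrix.vecMul_transpose,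
    D.H_mulVec_pinv_mulVec_col hi, hV, mul_one]

theorem integrable_truncKernel_self (hk : IsIntegrableKernel k μ) (s : ℕ) :
    Integrable (fun x => D.truncKernel s x x) μ := by
  simp only [truncKernel, ← Finset.sum_filter, mul_assoc]
  exact integrable_finsetSum _ fun i _ => (hk.integrable_dotProduct_kvec_mul _ _).const_mul _

theorem diagIntegral_truncKernel (hk : IsIntegrableKernel k μ) (s : ℕ) :
    diagIntegral μ (D.truncKernel s) = ∑ i ∈ {i : Fin l | (i : ℕ) < s}, D.κ i := by
  simp only [diagIntegral, truncKernel, ← Finset.sum_filter, mul_assoc]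
  have hint (i : Fin l) : Integrable (fun x => D.κ i * (D.f i x * D.f i x)) μ :=
    (hk.integrable_dotProduct_kvec_mul _ _).const_mul _
  rw [integral_finsetSum _ fun i _ => hint i]
  simp only [integral_const_mul, D.κ_mul_integral_f_mul_f hk]

theorem diagIntegral_nystromKernel_sub (hk : IsIntegrableKernel k μ) (s : ℕ) :
    diagIntegral μ (fun x y => nystromKernel k Z x y - D.truncKernel s x y) =
      ∑ i ∈ {i : Fin l | s ≤ (i : ℕ)}, D.κ i := by
  rw [← sum_sub_sum_lt, ← D.trace_pinv_mul_gram_squareKernel, ← hk.diagIntegral_nystromKernel,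
    ← D.diagIntegral_truncKernel hk]
  exact integral_sub hk.integrable_nystromKernel_self (D.integrable_truncKernel_self hk s)

theorem kernel_eq_truncKernel : D.kernel = D.truncKernel l := by
  ext x y
  simp only [kernel, truncKernel, Fin.is_lt, if_true]

theorem diagIntegral_kernel_sub (hk : IsIntegrableKernel k μ) (s : ℕ) :
    diagIntegral μ (fun x y => D.kernel x y - D.truncKernel s x y) =
      ∑ i ∈ {i : Fin l | s ≤ (i : ℕ)}, D.κ i := by
  have hκ : ∑ i, D.κ i = diagIntegral μ D.kernel := by
    simp only [kernel_eq_truncKernel, D.diagIntegral_truncKernel hk, Fin.is_lt,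
      Finset.filter_true]
  rw [← sum_sub_sum_lt, hκ, kernel_eq_truncKernel, ← D.diagIntegral_truncKernel hk]
  exact integral_sub (D.integrable_truncKernel_self hk l) (D.integrable_truncKernel_self hk s)

theorem sum_κ_eq_partialTraceInf (s : ℕ) {C : Matrix (Fin l) (Fin l) ℝ}
    (hC : C * Cᵀ = pinv (gram k Z)) :
    ∑ i ∈ {i : Fin l | s ≤ (i : ℕ)}, D.κ i =
      partialTraceInf {i : Fin l | s ≤ (i : ℕ)} (Cᵀ * gram (squareKernel k μ) Z * C) := by
  set t : Finset (Fin l) := {i | s ≤ (i : ℕ)}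
  have hκ : ∀ i ∈ t, ∀ j ∉ t, D.κ i ≤ D.κ j := fun i hi j hj => D.antitone <| by
    simp only [t, Finset.mem_filter_univ, not_le] at hi hj
    exact Fin.le_def.2 (hj.le.trans hi)
  have hN : (D.H * C) * (D.H * C)ᵀ = D.V * Matrix.diagonal D.κ * D.Vᵀ := by
    rw [← D.svd, ← hC]
    simp only [Matrix.transpose_mul, Matrix.mul_assoc]
  rw [← partialTraceInf_transpose_mul_self hκ D.orthogonal hN, ← D.factor]
  simp only [Matrix.transpose_mul, Matrix.mul_assoc]

end MercerData

end Mercer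

section Rotation

variable {n F : Type*} [Fintype n] [NormedAddCommGroup F] [InnerProductSpace ℝ F]

/-- The vectors whose coefficients with respect to the family `q` are the columns of `C`. -/
noncomputable def colComb {m : Type*} (q : n → F) (C : Matrix n m ℝ) (i : m) : F :=
  ∑ a, C a i • q a

theorem inner_colComb {m : Type*} (q : n → F) (C : Matrix n m ℝ) (u : F) (i : m) :
    inner ℝ u (colComb q C i) = ((fun a => inner ℝ u (q a)) ᵥ* C) i := by
  simp only [colComb, inner_sum, inner_smul_right, Matrix.vecMul, dotProduct, mul_comm]

theorem gram_colComb {m : Type*} (q : n → F) (C : Matrix n m ℝ) :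
    Matrix.gram ℝ (colComb q C) = Cᵀ * Matrix.gram ℝ q * C := by
  ext i j
  rw [Matrix.gram_apply, inner_colComb, Matrix.mul_apply_eq_vecMul]
  congr 2
  ext a
  rw [real_inner_comm, inner_colComb, Matrix.mul_apply, Matrix.vecMul, dotProduct]
  exact Finset.sum_congr rfl fun b _ => by
    rw [Matrix.transpose_apply, Matrix.gram_apply, real_inner_comm, mul_comm]

theorem sum_inner_sq_le_of_isIdempotentElem_gram {p : n → F}
    (hp : IsIdempotentElem (Matrix.gram ℝ p)) (u : F) :
    ∑ i, inner ℝ u (p i) ^ 2 ≤ ‖u‖ ^ 2 := by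
  set x : n → ℝ := fun i => inner ℝ u (p i)
  set w : F := ∑ i, x i • p i
  have huw : inner ℝ u w = x ⬝ᵥ x := by
    simp only [w, inner_sum, inner_smul_right, dotProduct, x]
  have hww : ‖w‖ ^ 2 = x ⬝ᵥ Matrix.gram ℝ p *ᵥ x := by
    rw [← real_inner_self_eq_norm_sq, ← Matrix.star_dotProduct_gram_mulVec, star_trivial]
  have hproj : 0 ≤ x ⬝ᵥ x - x ⬝ᵥ Matrix.gram ℝ p *ᵥ x := by
    set P := Matrix.gram ℝ p
    have hsymm : Pᵀ = P := Matrix.isHermitian_gram ℝ p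
    have hP : P *ᵥ x ⬝ᵥ P *ᵥ x = x ⬝ᵥ P *ᵥ x := by
      rw [Matrix.dotProduct_mulVec, ← Matrix.mulVec_transpose, hsymm, Matrix.mulVec_mulVec, hp.eq,
        dotProduct_comm]
    have h : 0 ≤ (x - P *ᵥ x) ⬝ᵥ (x - P *ᵥ x) := Finset.sum_nonneg fun i _ => mul_self_nonneg _
    rw [sub_dotProduct, dotProduct_sub, dotProduct_sub, hP, dotProduct_comm (P *ᵥ x)] at h
    linarith
  have hdist : 0 ≤ ‖u - w‖ ^ 2 := sq_nonneg _
  rw [norm_sub_sq_real, huw, hww] at hdist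
  calc ∑ i, x i ^ 2 = x ⬝ᵥ x := by simp only [dotProduct, sq]
    _ ≤ ‖u‖ ^ 2 := by linarith

theorem exists_orthogonal_vecMul_eq_zero {l : ℕ} (g : ℕ → Fin l → ℝ) :
    ∃ W ∈ Matrix.orthogonalGroup (Fin l) ℝ, ∀ (i : Fin l) (j : ℕ), j < i → (g j ᵥ* W) i = 0 := by
  let v (i : Fin l) : EuclideanSpace ℝ (Fin l) := WithLp.toLp 2 (g i)
  have hl : Module.finrank ℝ (EuclideanSpace ℝ (Fin l)) = Fintype.card (Fin l) :=
    finrank_euclideanSpace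
  let e := EuclideanSpace.basisFun (Fin l) ℝ
  let b := InnerProductSpace.gramSchmidtOrthonormalBasis hl v
  refine ⟨e.toBasis.toMatrix b, e.toMatrix_orthonormalBasis_mem_unitary b, fun i j hji => ?_⟩
  have h : inner ℝ (b i) (v ⟨j, hji.trans i.is_lt⟩) = 0 :=
    InnerProductSpace.gramSchmidtOrthonormalBasis_inv_triangular hl v (Fin.lt_def.2 hji)
  rwa [EuclideanSpace.inner_eq_star_dotProduct, star_trivial] at h

end Rotation

section NystromFeatures

variable {E : Type*} {k : E → E → ℝ} {l : ℕ} {Z : Fin l → E} {n : Type*}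

/-- The squared norm of the coordinates indexed by `t` of the vector `Bᵀ k(Z, x)`. The case of
interest is `B Bᵀ = k(Z, Z)⁺`, when `x ↦ Bᵀ k(Z, x)` is a feature map of the kernel `k^Z`. -/
noncomputable def partialNormSq (k : E → E → ℝ) (Z : Fin l → E) (B : Matrix (Fin l) n ℝ)
    (t : Finset n) (x : E) : ℝ :=
  ∑ i ∈ t, (B.col i ⬝ᵥ kvec k Z x) ^ 2

theorem partialNormSq_nonneg (B : Matrix (Fin l) n ℝ) (t : Finset n) (x : E) :
    0 ≤ partialNormSq k Z B t x :=
  Finset.sum_nonneg fun _ _ => sq_nonneg _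

variable [MeasurableSpace E] {μ : Measure E}

namespace IsIntegrableKernel

theorem measurable_partialNormSq (hk : IsIntegrableKernel k μ) (B : Matrix (Fin l) n ℝ)
    (t : Finset n) : Measurable (partialNormSq k Z B t) :=
  Finset.measurable_sum _ fun i _ => (Finset.measurable_sum _ fun a _ =>
    (hk.measurable.comp measurable_prodMk_left).const_mul (B a i)).pow_const 2

theorem integrable_sq_dotProduct_kvec (hk : IsIntegrableKernel k μ) (c : Fin l → ℝ) :
    Integrable (fun x => (c ⬝ᵥ kvec k Z x) ^ 2) μ := by
  simpa only [sq] using hk.integrable_dotProduct_kvec_mul c c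

theorem integrable_partialNormSq (hk : IsIntegrableKernel k μ) (B : Matrix (Fin l) n ℝ)
    (t : Finset n) : Integrable (partialNormSq k Z B t) μ :=
  integrable_finsetSum _ fun i _ => hk.integrable_sq_dotProduct_kvec (B.col i)

theorem integral_partialNormSq (hk : IsIntegrableKernel k μ) (B : Matrix (Fin l) n ℝ)
    (t : Finset n) :
    ∫ x, partialNormSq k Z B t x ∂μ =
      ∑ i ∈ t, (Bᵀ * gram (squareKernel k μ) Z * B) i i := by
  simp only [partialNormSq]
  rw [integral_finsetSum _ fun i _ => hk.integrable_sq_dotProduct_kvec _]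
  refine Finset.sum_congr rfl fun i _ => ?_
  simp only [sq]
  rw [hk.integral_dotProduct_kvec_mul, Matrix.dotProduct_mulVec]
  rfl

variable [Fintype n] [DecidableEq n]

theorem partialTraceInf_nonneg (hk : IsIntegrableKernel k μ) (B : Matrix (Fin l) n ℝ)
    (t : Finset n) : 0 ≤ partialTraceInf t (Bᵀ * gram (squareKernel k μ) Z * B) := by
  refine Real.sInf_nonneg fun _ ⟨W, _, hW⟩ => ?_
  have hconj : Wᵀ * (Bᵀ * gram (squareKernel k μ) Z * B) * W =
      (B * W)ᵀ * gram (squareKernel k μ) Z * (B * W) := by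
    simp only [Matrix.transpose_mul, Matrix.mul_assoc]
  simp only [← hW, hconj, ← hk.integral_partialNormSq]
  exact integral_nonneg (partialNormSq_nonneg _ _)

theorem partialTraceInf_le_integral (hk : IsIntegrableKernel k μ) (B : Matrix (Fin l) n ℝ)
    (t : Finset n) :
    partialTraceInf t (Bᵀ * gram (squareKernel k μ) Z * B) ≤
      ∫ x, partialNormSq k Z B t x ∂μ := by
  rw [hk.integral_partialNormSq]
  simpa using partialTraceInf_le t (Bᵀ * gram (squareKernel k μ) Z * B) (one_mem _)

end IsIntegrableKernel

theorem IsL2FeatureMap.sum_norm_operator_colComb_sq {F : Type*} [NormedAddCommGroup F]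
    [InnerProductSpace ℝ F] {Φ : E → F} (hΦ : IsL2FeatureMap Φ μ) (hk : IsIntegrableKernel k μ)
    (hΦk : ∀ x y, inner ℝ (Φ x) (Φ y) = k x y) (B : Matrix (Fin l) n ℝ) (t : Finset n) :
    ∑ i ∈ t, ‖hΦ.operator (colComb (Φ ∘ Z) B i)‖ ^ 2 = ∫ x, partialNormSq k Z B t x ∂μ := by
  have hinner (x : E) (i : n) : inner ℝ (Φ x) (colComb (Φ ∘ Z) B i) = B.col i ⬝ᵥ kvec k Z x := by
    simp only [inner_colComb, Function.comp_apply, hΦk, hk.symm x, Matrix.vecMul]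
    exact dotProduct_comm _ _
  simp only [partialNormSq]
  rw [integral_finsetSum _ fun i _ => hk.integrable_sq_dotProduct_kvec _]
  simp only [hΦ.norm_operator_sq, hinner]

theorem IsIntegrableKernel.summable_of_isEigenvalueSeq [SFinite μ] (hk : IsIntegrableKernel k μ)
    {σ : ℕ → ℝ} (hσ : IsEigenvalueSeq hk.integralOperator σ) : Summable σ := by
  obtain ⟨F, _, _, _, Φ, hΦk⟩ := exists_feature_map_of_posSemidef hk.posSemidef
  have hΦ := hk.isL2FeatureMap hΦk
  rw [← hΦ.operator_comp_adjoint hk hΦk] at hσ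
  exact hσ.summable_of_sum_norm_sq_le fun _ _ he => hΦ.sum_norm_operator_sq_le he

theorem IsIntegrableKernel.exists_integral_partialNormSq_le_tsum [SFinite μ]
    (hk : IsIntegrableKernel k μ) {σ : ℕ → ℝ} (hσ : IsEigenvalueSeq hk.integralOperator σ)
    (Z : Fin l → E) (s : ℕ) :
    ∃ B : Matrix (Fin l) (Fin l) ℝ, B * Bᵀ = pinv (gram k Z) ∧
      ∫ x, partialNormSq k Z B {i | s ≤ (i : ℕ)} x ∂μ ≤ ∑' i, σ (i + s) := by
  obtain ⟨F, _, _, _, Φ, hΦk⟩ := exists_feature_map_of_posSemidef hk.posSemidef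
  have hΦ := hk.isL2FeatureMap hΦk
  have hσ_summable := hk.summable_of_isEigenvalueSeq hσ
  rw [← hΦ.operator_comp_adjoint hk hΦk] at hσ
  obtain ⟨v, hv, hAv⟩ := hσ.exists_singular_vectors <|
    isCompactOperator_of_sum_norm_sq_le fun _ _ he => hΦ.sum_norm_operator_sq_le he
  have hG : (gram k Z).PosSemidef := hk.posSemidef.submatrix Z
  obtain ⟨C, hC⟩ := exists_mul_transpose_self_eq (posSemidef_pinv hG)
  obtain ⟨W, hW, hWv⟩ := exists_orthogonal_vecMul_eq_zero fun j =>
    (fun a => inner ℝ (v j) (Φ (Z a))) ᵥ* C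
  have hWW : W * Wᵀ = 1 := (Matrix.mem_orthogonalGroup_iff _ _).1 hW
  have hB : C * W * (C * W)ᵀ = pinv (gram k Z) := by
    rw [Matrix.transpose_mul, Matrix.mul_assoc, ← Matrix.mul_assoc W, hWW, Matrix.one_mul, hC]
  refine ⟨C * W, hB, ?_⟩
  have hgram : Matrix.gram ℝ (Φ ∘ Z) = gram k Z := Matrix.ext fun a b => hΦk (Z a) (Z b)
  have hidem : IsIdempotentElem (Matrix.gram ℝ (colComb (Φ ∘ Z) (C * W))) := by
    rw [gram_colComb, hgram]
    exact isIdempotentElem_transpose_mul_mul hB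
  rw [← hΦ.sum_norm_operator_colComb_sq hk hΦk]
  refine sum_norm_sq_le_tsum_of_inner_eq_zero hσ.nonneg hσ_summable hv hAv (fun u =>
    (Finset.sum_le_univ_sum_of_nonneg fun i => sq_nonneg _).trans
      (sum_inner_sq_le_of_isIdempotentElem_gram hidem u)) fun i hi j hj => ?_
  rw [inner_colComb, ← Matrix.vecMul_vecMul]
  exact hWv i j (hj.trans_le ((Finset.mem_filter_univ i).1 hi))

end NystromFeatures

section Sample

variable {E : Type*} [MeasurableSpace E] {k : E → E → ℝ} {μ : Measure E} {l M : ℕ}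

theorem integral_empiricalMeasure (X : Fin M → E) {g : E → ℝ} (hg : Measurable g) :
    ∫ x, g x ∂empiricalMeasure X = (M : ℝ)⁻¹ * ∑ j, g (X j) := by
  rw [empiricalMeasure, integral_smul_measure, integral_finsetSum_measure]
  · simp [integral_dirac' _ _ hg.stronglyMeasurable]
  · exact fun j _ => integrable_dirac' hg.stronglyMeasurable (by simp)

theorem IsIntegrableKernel.to_empiricalMeasure (hk : IsIntegrableKernel k μ) (X : Fin M → E) :
    IsIntegrableKernel k (empiricalMeasure X) where
  posSemidef := hk.posSemidef
  measurable := hk.measurable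
  integrable_diag := by
    obtain rfl | hM := M.eq_zero_or_pos
    · simp [empiricalMeasure]
    have hdiag : Measurable fun x => k x x :=
      hk.measurable.comp (measurable_id.prodMk measurable_id)
    refine Integrable.smul_measure (integrable_finsetSum_measure.2 fun j _ =>
      integrable_dirac' hdiag.stronglyMeasurable (by simp)) (by simp [hM.ne'])

variable {Ω : Type*} [MeasurableSpace Ω] {P : Measure Ω} {X : Fin M → Ω → E} {g : E → ℝ}

theorem integrable_comp_of_hasLaw {Y : Ω → E} (hY : HasLaw Y μ P)
    (hg : Integrable g μ) : Integrable (fun ω => g (Y ω)) P :=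
  (hY.map_eq ▸ hg).comp_aemeasurable hY.aemeasurable

theorem integrable_integral_empiricalMeasure (hlaw : ∀ j, HasLaw (X j) μ P) (hg : Measurable g)
    (hgμ : Integrable g μ) :
    Integrable (fun ω => ∫ x, g x ∂empiricalMeasure fun j => X j ω) P := by
  simp only [integral_empiricalMeasure _ hg]
  exact (integrable_finsetSum _ fun j _ => integrable_comp_of_hasLaw (hlaw j) hgμ).const_mul _

theorem integral_integral_empiricalMeasure (hM : 0 < M) (hlaw : ∀ j, HasLaw (X j) μ P)
    (hg : Measurable g) (hgμ : Integrable g μ) :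
    ∫ ω, ∫ x, g x ∂empiricalMeasure (fun j => X j ω) ∂P = ∫ x, g x ∂μ := by
  have hcomp (j : Fin M) : ∫ ω, g (X j ω) ∂P = ∫ x, g x ∂μ :=
    (hlaw j).integral_comp hg.aestronglyMeasurable
  simp only [integral_empiricalMeasure _ hg]
  rw [integral_const_mul,
    integral_finsetSum _ fun j _ => integrable_comp_of_hasLaw (hlaw j) hgμ]
  simp only [hcomp, Finset.sum_const, Finset.card_univ, Fintype.card_fin, nsmul_eq_mul]
  exact inv_mul_cancel_left₀ (Nat.cast_ne_zero.2 hM.ne') _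

theorem IsIntegrableKernel.aestronglyMeasurable_gram_squareKernel
    (hk : IsIntegrableKernel k μ) (hlaw : ∀ j, HasLaw (X j) μ P) (Z : Fin l → E) :
    AEStronglyMeasurable
      (fun ω => gram (squareKernel k (empiricalMeasure fun j => X j ω)) Z) P := by
  have hentry (a b : Fin l) : AEMeasurable
      (fun ω => gram (squareKernel k (empiricalMeasure fun j => X j ω)) Z a b) P := by
    simp only [gram, squareKernel, Matrix.of_apply, hk.symm _ (Z b)]
    exact (integrable_integral_empiricalMeasure hlaw
      ((hk.measurable.comp measurable_prodMk_left).mul (hk.measurable.comp measurable_prodMk_left))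
      ((hk.memLp_apply (Z a)).integrable_mul (hk.memLp_apply (Z b)))).aemeasurable
  have hpi : AEMeasurable (fun ω (a b : Fin l) =>
      gram (squareKernel k (empiricalMeasure fun j => X j ω)) Z a b) P :=
    aemeasurable_pi_iff.2 fun a => aemeasurable_pi_iff.2 fun b => hentry a b
  exact hpi.aestronglyMeasurable

theorem IsIntegrableKernel.integrable_partialTraceInf {n : Type*} [Fintype n] [DecidableEq n]
    (hk : IsIntegrableKernel k μ) (hlaw : ∀ j, HasLaw (X j) μ P) (Z : Fin l → E)
    (B : Matrix (Fin l) n ℝ) (t : Finset n) :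
    Integrable (fun ω => partialTraceInf t
      (Bᵀ * gram (squareKernel k (empiricalMeasure fun j => X j ω)) Z * B)) P := by
  have hcont : Continuous fun A : Matrix (Fin l) (Fin l) ℝ => partialTraceInf t (Bᵀ * A * B) :=
    (continuous_partialTraceInf t).comp (by fun_prop)
  refine Integrable.mono' (integrable_integral_empiricalMeasure hlaw
    (hk.measurable_partialNormSq (Z := Z) B t) (hk.integrable_partialNormSq B t))
    (hcont.comp_aestronglyMeasurable (hk.aestronglyMeasurable_gram_squareKernel hlaw Z))
    (ae_of_all P fun ω => ?_)
  have hkX := hk.to_empiricalMeasure fun j => X j ω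
  rw [Real.norm_of_nonneg (hkX.partialTraceInf_nonneg B t)]
  exact hkX.partialTraceInf_le_integral B t

theorem IsIntegrableKernel.integral_partialTraceInf_le {n : Type*} [Fintype n] [DecidableEq n]
    (hk : IsIntegrableKernel k μ) (hM : 0 < M) (hlaw : ∀ j, HasLaw (X j) μ P) (Z : Fin l → E)
    (B : Matrix (Fin l) n ℝ) (t : Finset n) :
    ∫ ω, partialTraceInf t
      (Bᵀ * gram (squareKernel k (empiricalMeasure fun j => X j ω)) Z * B) ∂P ≤
      ∫ x, partialNormSq k Z B t x ∂μ := by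
  have hmeas : Measurable (partialNormSq k Z B t) := hk.measurable_partialNormSq B t
  have hint : Integrable (partialNormSq k Z B t) μ := hk.integrable_partialNormSq B t
  rw [← integral_integral_empiricalMeasure hM hlaw hmeas hint]
  exact integral_mono (hk.integrable_partialTraceInf hlaw Z B t)
    (integrable_integral_empiricalMeasure hlaw hmeas hint) fun ω =>
      (hk.to_empiricalMeasure fun j => X j ω).partialTraceInf_le_integral B t

end Sample

end Nystrom

theorem proposition4p7_general
    {E : Type*} [MeasurableSpace E] (μ : Measure E) [SFinite μ]
    (k : E → E → ℝ) (hk : Nystrom.IsIntegrableKernel k μ)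
    (σ : ℕ → ℝ) (hσ : Nystrom.IsEigenvalueSeq hk.integralOperator σ)
    {l : ℕ} (Z : Fin l → E) (s : ℕ)
    {Ω : Type*} [MeasurableSpace Ω] (P : Measure Ω)
    {M : ℕ} (hM : 0 < M) (X : Fin M → Ω → E) (hlaw : ∀ j, HasLaw (X j) μ P)
    (D : ∀ ω, Nystrom.MercerData k Z (Nystrom.empiricalMeasure fun j => X j ω)) :
    Integrable (fun ω => Nystrom.diagIntegral (Nystrom.empiricalMeasure fun j => X j ω)
        (fun x y => Nystrom.nystromKernel k Z x y - (D ω).truncKernel s x y)) P ∧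
    Integrable (fun ω => Nystrom.diagIntegral (Nystrom.empiricalMeasure fun j => X j ω)
        (fun x y => (D ω).kernel x y - (D ω).truncKernel s x y)) P ∧
    ∫ ω, Nystrom.diagIntegral (Nystrom.empiricalMeasure fun j => X j ω)
        (fun x y => Nystrom.nystromKernel k Z x y - (D ω).truncKernel s x y) ∂P =
      ∫ ω, Nystrom.diagIntegral (Nystrom.empiricalMeasure fun j => X j ω)
        (fun x y => (D ω).kernel x y - (D ω).truncKernel s x y) ∂P ∧
    Summable (fun i => σ (i + s)) ∧
    ∫ ω, Nystrom.diagIntegral (Nystrom.empiricalMeasure fun j => X j ω)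
        (fun x y => (D ω).kernel x y - (D ω).truncKernel s x y) ∂P ≤
      ∑' i, σ (i + s) := by
  obtain ⟨B, hB, hle⟩ := hk.exists_integral_partialNormSq_le_tsum hσ Z s
  have hkX (ω : Ω) := hk.to_empiricalMeasure fun j => X j ω
  have hint := hk.integrable_partialTraceInf hlaw Z B {i | s ≤ (i : ℕ)}
  simp only [(D _).diagIntegral_nystromKernel_sub (hkX _), (D _).diagIntegral_kernel_sub (hkX _),
    (D _).sum_κ_eq_partialTraceInf s hB]
  exact ⟨hint, hint, trivial, (summable_nat_add_iff s).2 (hk.summable_of_isEigenvalueSeq hσ),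
    (hk.integral_partialTraceInf_le hM hlaw Z B _).trans hle⟩

theorem proposition4p7
    {E : Type*} [MeasurableSpace E] (μ : Measure E) [IsProbabilityMeasure μ]
    (k : E → E → ℝ) (hk : Nystrom.IsIntegrableKernel k μ)
    (σ : ℕ → ℝ) (hσ : Nystrom.IsEigenvalueSeq hk.integralOperator σ)
    {l : ℕ} (Z : Fin l → E) (s : ℕ)
    {Ω : Type*} [MeasurableSpace Ω] (P : Measure Ω) [IsProbabilityMeasure P]
    {M : ℕ} (hM : 0 < M) (X : Fin M → Ω → E)
    (hlaw : ∀ j, HasLaw (X j) μ P) (hindep : iIndepFun X P)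
    (D : ∀ ω, Nystrom.MercerData k Z (Nystrom.empiricalMeasure fun j => X j ω)) :
    Integrable (fun ω => Nystrom.diagIntegral (Nystrom.empiricalMeasure fun j => X j ω)
        (fun x y => Nystrom.nystromKernel k Z x y - (D ω).truncKernel s x y)) P ∧
    Integrable (fun ω => Nystrom.diagIntegral (Nystrom.empiricalMeasure fun j => X j ω)
        (fun x y => (D ω).kernel x y - (D ω).truncKernel s x y)) P ∧
    ∫ ω, Nystrom.diagIntegral (Nystrom.empiricalMeasure fun j => X j ω)
        (fun x y => Nystrom.nystromKernel k Z x y - (D ω).truncKernel s x y) ∂P =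
      ∫ ω, Nystrom.diagIntegral (Nystrom.empiricalMeasure fun j => X j ω)
        (fun x y => (D ω).kernel x y - (D ω).truncKernel s x y) ∂P ∧
    Summable (fun i => σ (i + s)) ∧
    ∫ ω, Nystrom.diagIntegral (Nystrom.empiricalMeasure fun j => X j ω)
        (fun x y => (D ω).kernel x y - (D ω).truncKernel s x y) ∂P ≤
      ∑' i, σ (i + s) :=
  proposition4p7_general μ k hk σ hσ Z s P hM X hlaw D
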